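/- Let $q>1$ and $n\ge 2$ be integers ($q$ not necessarily a prime power). A quantum code $[[n,k,d]]_q$ is a subspace $\mathcal C\subseteq(\mathbb C^q)^{\otimes n}$ of dimension $q^k$ with minimum distance $d$. Here the minimum distance is the largest $d$ such that every linear operator $E$ on $(\mathbb C^q)^{\otimes n}$ acting as the identity on all but fewer than $d$ of the tensor factors is detected by $\mathcal C$, i.e. there is a scalar $c_E$ with $\langle u,Ev\rangle=c_E\langle u,v\rangle$ for all $u,v\in\mathcal C$; if $\dim\mathcal C=1$, it is required in addition, as usual, that $c_E=q^{-n}\operatorname{tr}E$. The code is called quantum MDS if equality holds in the quantum Singleton bound $n+2\ge k+2d$. Then quantum MDS codes $[[n,n-2,2]]_q$ exist for every even $n\ge 2$. If $q$ is odd or divisible by $4$, they exist for every $n\ge 2$. -/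

import Mathlib

namespace QuantumCode

/-- The Hilbert space `(ℂ^q)^{⊗ n}` of `n` qudits of dimension `q`, written in the orthonormal
computational basis `|x₁ … xₙ⟩`, `x ∈ {0, …, q - 1}ⁿ`. -/
abbrev Qudits (n q : ℕ) : Type := EuclideanSpace ℂ (Fin n → Fin q)

/-- Linear operators on `n` qudits, as matrices in the computational basis. -/
abbrev Operator (n q : ℕ) : Type := Matrix (Fin n → Fin q) (Fin n → Fin q) ℂ

/-- `A` acts as the identity on all qudits outside `S`, that is, `A = B ⊗ 1` for some operator `B`
on the qudits in `S`. -/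
def ActsOnlyOn {n q : ℕ} (A : Operator n q) (S : Finset (Fin n)) : Prop :=
  ∃ B : Matrix (S → Fin q) (S → Fin q) ℂ, ∀ x y : Fin n → Fin q,
    ((∀ i, i ∉ S → x i = y i) → A x y = B (fun i => x i) (fun i => y i)) ∧
    (¬ (∀ i, i ∉ S → x i = y i) → A x y = 0)

/-- The Knill–Laflamme condition for detecting the error `A`: the compression of `A` to the code
is a scalar. -/
def Detects {n q : ℕ} (C : Submodule ℂ (Qudits n q)) (A : Operator n q) : Prop :=
  ∃ c : ℂ, ∀ u ∈ C, ∀ v ∈ C,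
    inner ℂ u (Matrix.toEuclideanLin A v) = c * inner ℂ u v

/-- `A` is purely detected: the scalar is the normalized trace of `A`, so the code does not
distinguish `A` from its scalar part. -/
def PurelyDetects {n q : ℕ} (C : Submodule ℂ (Qudits n q)) (A : Operator n q) : Prop :=
  ∀ u ∈ C, ∀ v ∈ C,
    inner ℂ u (Matrix.toEuclideanLin A v) = (A.trace / (q : ℂ) ^ n) * inner ℂ u v

/-- The minimum distance of `C` is at least `d`: every error that affects fewer than `d` qudits is
detected. For one-dimensional codes this condition is void, and by the usual convention the
errors have to be purely detected. -/
def DistanceAtLeast {n q : ℕ} (C : Submodule ℂ (Qudits n q)) (d : ℕ) : Prop :=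
  ∀ (S : Finset (Fin n)) (A : Operator n q), S.card < d → ActsOnlyOn A S →
    Detects C A ∧ (Module.finrank ℂ C = 1 → PurelyDetects C A)

/-- `C` is a quantum code `[[n, k, d]]_q`: a subspace of dimension `q ^ k` whose minimum distance
is exactly `d`. -/
def IsCode {n q : ℕ} (C : Submodule ℂ (Qudits n q)) (k d : ℕ) : Prop :=
  Module.finrank ℂ C = q ^ k ∧ IsGreatest {e : ℕ | DistanceAtLeast C e} d

/-- `C` is a quantum MDS code `[[n, k, d]]_q`: equality holds in the quantum Singleton bound
`n + 2 ≥ k + 2 d`. -/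
def IsMDSCode {n q : ℕ} (C : Submodule ℂ (Qudits n q)) (k d : ℕ) : Prop :=
  IsCode C k d ∧ n + 2 = k + 2 * d

end QuantumCode

/-! Label the levels by a ring `R` with `q` elements and take units `a i` with sum zero. The code
consists of the states supported on labels of coordinate sum zero and constant on cosets of `R • a`;
both conditions are compatible because `a` has sum zero, and each lowers the exponent of `q ^ n` by
one. An error on qudit `i` has no effective off-diagonal part, since changing one coordinate changes
the sum. Its diagonal part averages to the normalized trace, since `t * a i` runs through all of
`R`. A diagonal two-qudit projection shows that the distance is not larger. It remains to find the
units: pairs `1, -1` for even `n`, and additionally a triple `1, u, -(1 + u)` for odd `n`. -/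

namespace QuantumCode

section UnitSums

/-- For even `n`, zero is a sum of `n` units. -/
lemma exists_units_sum_eq_zero_of_even (R : Type) [CommRing R] {n : ℕ} (hn : Even n) :
    ∃ a : Fin n → Rˣ, ∑ i, (a i : R) = 0 := by
  obtain ⟨k, rfl⟩ := hn
  exact ⟨Fin.append (fun _ => 1) (fun _ => -1), by
    simp only [Fin.sum_univ_add, Fin.append_left, Fin.append_right]
    simp⟩

/-- If `u` and `1 + u` are units, then zero is a sum of `n` units for every `n ≥ 2`. -/
lemma exists_units_sum_eq_zero (R : Type) [CommRing R] {u : R} (hu : IsUnit u)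
    (hu' : IsUnit (1 + u)) {n : ℕ} (hn : 2 ≤ n) : ∃ a : Fin n → Rˣ, ∑ i, (a i : R) = 0 := by
  rcases Nat.even_or_odd n with h | h
  · exact exists_units_sum_eq_zero_of_even R h
  · obtain ⟨m, rfl⟩ : ∃ m, n = 3 + m := ⟨n - 3, by obtain ⟨k, rfl⟩ := h; omega⟩
    have hm : Even m := by
      obtain ⟨k, hk⟩ := h
      exact ⟨k - 1, by omega⟩
    obtain ⟨b, hb⟩ := exists_units_sum_eq_zero_of_even R hm
    obtain ⟨u, rfl⟩ := hu
    obtain ⟨v, hv⟩ := hu'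
    refine ⟨Fin.append ![1, u, -v] b, ?_⟩
    simp [Fin.sum_univ_add, hb, Fin.sum_univ_three, hv]

/-- If `q` is odd or divisible by `4`, some commutative ring with `q` elements contains a unit `u`
such that `1 + u` is a unit. -/
lemma exists_ring_unit_add_one_unit {q : ℕ} (hq : 0 < q) (h : Odd q ∨ 4 ∣ q) :
    ∃ (R : Type) (_ : CommRing R), Nat.card R = q ∧ ∃ u : R, IsUnit u ∧ IsUnit (1 + u) := by
  obtain ⟨k, m, hm, rfl⟩ := Nat.exists_eq_two_pow_mul_odd hq.ne'
  have h2 : IsUnit (1 + 1 : ZMod m) := by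
    have := (ZMod.unitOfCoprime 2 (Nat.coprime_two_left.2 hm)).isUnit
    rw [ZMod.coe_unitOfCoprime] at this
    rw [one_add_one_eq_two]
    exact_mod_cast this
  rcases Nat.eq_zero_or_pos k with rfl | hk
  · exact ⟨ZMod m, inferInstance, by simp, 1, isUnit_one, h2⟩
  · have hk2 : 2 ≤ k := by
      by_contra hlt
      obtain rfl : k = 1 := by omega
      obtain ⟨j, rfl⟩ := hm
      -- Here `q` would be congruent to 2 modulo 4.
      rcases h with ⟨i, hi⟩ | ⟨i, hi⟩ <;> omega
    have : Fact (Nat.Prime 2) := ⟨Nat.prime_two⟩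
    have hcard : Nat.card (GaloisField 2 k) = 2 ^ k := GaloisField.card 2 k hk.ne'
    have : ∃ w : GaloisField 2 k, w ≠ 0 ∧ 1 + w ≠ 0 := by
      -- Otherwise the field, of order at least 4, would equal `{0, -1}`.
      by_contra! hc
      have hle : Set.ncard (Set.univ : Set (GaloisField 2 k)) ≤
          Set.ncard {0, (-1 : GaloisField 2 k)} := by
        refine Set.ncard_le_ncard (fun w _ => ?_) (Set.toFinite _)
        by_cases hw : w = 0
        · simp [hw]
        · right
          exact eq_neg_of_add_eq_zero_right (hc w hw)
      rw [Set.ncard_univ, hcard] at hle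
      have h1 := Set.ncard_insert_le (0 : GaloisField 2 k) {-1}
      rw [Set.ncard_singleton] at h1
      have h4 : 2 ^ 2 ≤ 2 ^ k := Nat.pow_le_pow_right (by norm_num) hk2
      omega
    obtain ⟨w, hw, hw'⟩ := this
    refine ⟨GaloisField 2 k × ZMod m, inferInstance, by simp [hcard], (w, 1), ?_, ?_⟩
    · exact Prod.isUnit_iff.2 ⟨hw.isUnit, isUnit_one⟩
    · exact Prod.isUnit_iff.2 ⟨hw'.isUnit, h2⟩

end UnitSums

section ShiftCode

variable {R : Type} [CommRing R] {n q : ℕ}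

/-- Translation of a basis label by `t • a`, under the labelling `e` of the levels by `R`. -/
def shift (e : Fin q ≃ R) (a : Fin n → Rˣ) (t : R) : (Fin n → Fin q) ≃ (Fin n → Fin q) where
  toFun x i := e.symm (e (x i) + t * a i)
  invFun x i := e.symm (e (x i) - t * a i)
  left_inv x := by ext; simp
  right_inv x := by ext; simp

@[simp]
lemma shift_apply (e : Fin q ≃ R) (a : Fin n → Rˣ) (t : R) (x : Fin n → Fin q) (i : Fin n) :
    e (shift e a t x i) = e (x i) + t * a i := by
  simp [shift]

lemma sum_shift (e : Fin q ≃ R) {a : Fin n → Rˣ} (ha : ∑ i, (a i : R) = 0) (t : R)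
    (x : Fin n → Fin q) : ∑ i, e (shift e a t x i) = ∑ i, e (x i) := by
  simp [Finset.sum_add_distrib, ← Finset.mul_sum, ha]

/-- The states supported on labels with coordinate sum zero and invariant under all translations
by multiples of `a`. -/
def shiftCode (e : Fin q ≃ R) (a : Fin n → Rˣ) : Submodule ℂ (Qudits n q) where
  carrier := {f | (∀ x, ∑ i, e (x i) ≠ 0 → f x = 0) ∧ ∀ t x, f (shift e a t x) = f x}
  zero_mem' := by simp
  add_mem' := by
    rintro f g ⟨hf, hf'⟩ ⟨hg, hg'⟩
    exact ⟨fun x hx => by simp [hf x hx, hg x hx], fun t x => by simp [hf', hg']⟩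
  smul_mem' := by
    rintro c f ⟨hf, hf'⟩
    exact ⟨fun x hx => by simp [hf x hx], fun t x => by simp [hf']⟩

/-! ### Dimension of the code -/

/-- The label of the form `(0, -∑ g, g)`. -/
def labelOfTail {m : ℕ} (e : Fin q ≃ R) (g : Fin m → R) : Fin (m + 2) → Fin q :=
  fun i => e.symm ((Fin.cons 0 (Fin.cons (-∑ j, g j) g) : Fin (m + 2) → R) i)

lemma labelOfTail_eq {m : ℕ} (e : Fin q ≃ R) (x : Fin (m + 2) → Fin q) (h0 : e (x 0) = 0)
    (hx : ∑ i, e (x i) = 0) : labelOfTail e (fun j => e (x j.succ.succ)) = x := by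
  funext i
  rw [labelOfTail, Equiv.symm_apply_eq]
  rw [Fin.sum_univ_succ, Fin.sum_univ_succ, h0, zero_add] at hx
  refine Fin.cases ?_ (fun i => Fin.cases ?_ (fun i => ?_) i) i
  · simp [h0]
  · simp only [Fin.cons_succ, Fin.cons_zero]
    exact (eq_neg_of_add_eq_zero_left hx).symm
  · simp

/-- Evaluation on the labels `(0, -∑ g, g)`, as a linear map on the code. -/
def evalTail {m : ℕ} (e : Fin q ≃ R) (a : Fin (m + 2) → Rˣ) :
    shiftCode e a →ₗ[ℂ] ((Fin m → R) → ℂ) where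
  toFun f g := f.1 (labelOfTail e g)
  map_add' f g := by ext; simp
  map_smul' c f := by ext; simp

/-- Since `a 0` is a unit, every orbit of sum-zero labels contains a label with first coordinate
zero, which is determined by its tail. -/
lemma evalTail_injective {m : ℕ} (e : Fin q ≃ R) {a : Fin (m + 2) → Rˣ}
    (ha : ∑ i, (a i : R) = 0) : Function.Injective (evalTail e a) := by
  rw [injective_iff_map_eq_zero]
  rintro ⟨f, hf⟩ h
  ext x
  by_cases hx : ∑ i, e (x i) = 0
  · have h0 := congrFun h (fun j => e (shift e a (-(e (x 0) * ↑(a 0)⁻¹)) x j.succ.succ))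
    change f _ = 0 at h0
    rw [labelOfTail_eq e _ (by simp) (by rw [sum_shift e ha, hx]), hf.2] at h0
    exact h0
  · exact hf.1 x hx

lemma evalTail_surjective {m : ℕ} (e : Fin q ≃ R) {a : Fin (m + 2) → Rˣ}
    (ha : ∑ i, (a i : R) = 0) : Function.Surjective (evalTail e a) := by
  classical
  intro h
  let f : Qudits (m + 2) q := WithLp.toLp 2 fun x =>
    if ∑ i, e (x i) = 0 then
      h (fun j => e (x j.succ.succ) - e (x 0) * ↑(a 0)⁻¹ * a j.succ.succ) else 0
  have hf : f ∈ shiftCode e a := by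
    refine ⟨fun x hx => by simp [f, hx], fun t x => ?_⟩
    have hs : (fun j : Fin m => e (shift e a t x j.succ.succ) -
        e (shift e a t x 0) * ↑(a 0)⁻¹ * a j.succ.succ) =
        fun j => e (x j.succ.succ) - e (x 0) * ↑(a 0)⁻¹ * a j.succ.succ := by
      funext j
      simp only [shift_apply]
      linear_combination (-(t * (a j.succ.succ : R))) * (a 0).mul_inv
    change (if _ then _ else _) = if _ then _ else _
    rw [sum_shift e ha, hs]
  refine ⟨⟨f, hf⟩, ?_⟩
  funext g
  change (if _ then _ else _) = _
  rw [if_pos (by simp [labelOfTail, Fin.sum_univ_succ])]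
  simp [labelOfTail]

lemma finrank_shiftCode {m : ℕ} (e : Fin q ≃ R) {a : Fin (m + 2) → Rˣ}
    (ha : ∑ i, (a i : R) = 0) : Module.finrank ℂ (shiftCode e a) = q ^ m := by
  classical
  have : Fintype R := Fintype.ofEquiv _ e
  rw [(LinearEquiv.ofBijective (evalTail e a)
    ⟨evalTail_injective e ha, evalTail_surjective e ha⟩).finrank_eq,
    Module.finrank_fintype_fun_eq_card, Fintype.card_fun, ← Fintype.card_congr e]
  simp

/-! ### Detection of single-qudit errors -/

lemma inner_toEuclideanLin (A : Operator n q) (u v : Qudits n q) :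
    inner ℂ u (Matrix.toEuclideanLin A v) = ∑ x, ∑ y, star (u x) * A x y * v y := by
  simp only [PiLp.inner_apply, Matrix.toLpLin_apply, Matrix.mulVec, dotProduct,
    RCLike.inner_apply, Finset.sum_mul]
  refine Finset.sum_congr rfl fun x _ => Finset.sum_congr rfl fun y _ => ?_
  simp only [starRingEnd_apply]
  ring

/-- An operator on a single qudit compresses to a diagonal operator on the code. -/
lemma inner_eq_sum_diag (e : Fin q ≃ R) (a : Fin n → Rˣ) {A : Operator n q} {i : Fin n}
    (hA : ∀ x y, (¬ ∀ j, j ≠ i → x j = y j) → A x y = 0) {u v : Qudits n q}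
    (hu : u ∈ shiftCode e a) (hv : v ∈ shiftCode e a) :
    inner ℂ u (Matrix.toEuclideanLin A v) = ∑ x, A x x * (star (u x) * v x) := by
  rw [inner_toEuclideanLin]
  refine Finset.sum_congr rfl fun x _ => ?_
  rw [Finset.sum_eq_single x]
  · ring
  · intro y _ hyx
    by_cases h : ∀ j, j ≠ i → x j = y j
    · by_cases hx : ∑ j, e (x j) = 0
      · by_cases hy : ∑ j, e (y j) = 0
        · refine absurd (funext fun j => ?_) hyx
          by_cases hj : j = i
          · subst hj
            rw [← Finset.add_sum_erase _ _ (Finset.mem_univ j)] at hx hy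
            rw [Finset.sum_congr rfl fun k hk => by rw [h k (Finset.ne_of_mem_erase hk)]] at hx
            exact e.injective (add_right_cancel (hy.trans hx.symm))
          · exact (h j hj).symm
        · simp [hv.1 y hy]
      · simp [hu.1 x hx]
    · simp [hA x y h]
  · simp

/-- Errors on a single qudit are purely detected. -/
lemma purelyDetects_of_actsOnlyOn (e : Fin q ≃ R) (a : Fin n → Rˣ) {A : Operator n q}
    {S : Finset (Fin n)} {i : Fin n} (hS : S ⊆ {i}) (hA : ActsOnlyOn A S) :
    PurelyDetects (shiftCode e a) A := by
  classical
  have : Fintype R := Fintype.ofEquiv _ e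
  intro u hu v hv
  obtain ⟨B, hB⟩ := hA
  have hoff : ∀ x y, (¬ ∀ j, j ≠ i → x j = y j) → A x y = 0 := by
    refine fun x y h => (hB x y).2 fun h' => h fun j hj => h' j fun hjS => hj ?_
    simpa using hS hjS
  have hdep : ∀ x y : Fin n → Fin q, x i = y i → A x x = A y y := by
    intro x y hxy
    rw [(hB x x).1 fun _ _ => rfl, (hB y y).1 fun _ _ => rfl]
    have : (fun j : S => x j) = fun j : S => y j := by
      funext j
      have hj : (j : Fin n) = i := by simpa using hS j.2
      rw [hj, hxy]
    rw [this]
  have hqR : Fintype.card R = q := by simpa using (Fintype.card_congr e).symm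
  have hq : (q : ℂ) ≠ 0 := by
    rw [← hqR]
    exact_mod_cast Fintype.card_ne_zero
  -- Averages over an orbit of translations do not depend on the orbit.
  have hconst : ∀ x y : Fin n → Fin q,
      ∑ t, A (shift e a t x) (shift e a t x) = ∑ t, A (shift e a t y) (shift e a t y) := by
    intro x y
    -- This translation of `t` aligns the `i`-th coordinates of the two orbits.
    refine Fintype.sum_equiv (Equiv.addRight ((e (x i) - e (y i)) * ↑(a i)⁻¹)) _ _ fun t => ?_
    refine hdep _ _ (e.injective ?_)
    simp only [shift_apply, Equiv.coe_addRight]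
    linear_combination (-(e (x i) - e (y i))) * (a i).inv_mul
  have havg : ∀ F : (Fin n → Fin q) → ℂ, (∀ t x, F (shift e a t x) = F x) →
      (q : ℂ) * ∑ x, A x x * F x = ∑ x, (∑ t, A (shift e a t x) (shift e a t x)) * F x := by
    intro F hF
    have h1 : ∀ t : R, ∑ x, A x x * F x = ∑ x, A (shift e a t x) (shift e a t x) * F x := by
      intro t
      rw [← Equiv.sum_comp (shift e a t)]
      simp only [hF]
    calc (q : ℂ) * ∑ x, A x x * F x = ∑ _t : R, ∑ x, A x x * F x := by
          simp [hqR]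
      _ = ∑ t, ∑ x, A (shift e a t x) (shift e a t x) * F x :=
          Finset.sum_congr rfl fun t _ => h1 t
      _ = _ := by rw [Finset.sum_comm]; simp only [Finset.sum_mul]
  let x₀ : Fin n → Fin q := fun _ => e.symm 0
  set s := ∑ t, A (shift e a t x₀) (shift e a t x₀) with hs
  have hF : ∀ F : (Fin n → Fin q) → ℂ, (∀ t x, F (shift e a t x) = F x) →
      (q : ℂ) * ∑ x, A x x * F x = s * ∑ x, F x := by
    intro F hF
    rw [havg F hF, Finset.mul_sum]
    exact Finset.sum_congr rfl fun x _ => by rw [hconst x x₀]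
  have htr : (q : ℂ) * A.trace = s * (q : ℂ) ^ n := by
    -- The constant function 1 identifies `s` through the trace.
    have := hF (fun _ => 1) fun _ _ => rfl
    simpa [Matrix.trace] using this
  have huv : inner ℂ u v = ∑ x, star (u x) * v x := by
    simp only [PiLp.inner_apply, RCLike.inner_apply, starRingEnd_apply]
    exact Finset.sum_congr rfl fun x _ => mul_comm _ _
  have hmain := hF (fun x => star (u x) * v x) fun t x => by simp only [hu.2, hv.2]
  rw [inner_eq_sum_diag e a hoff hu hv, huv]
  have hqn : (q : ℂ) ^ n ≠ 0 := pow_ne_zero _ hq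
  have hs' : s = q * (A.trace / (q : ℂ) ^ n) := by
    field_simp
    linear_combination -htr
  rw [hs', mul_assoc] at hmain
  exact mul_left_cancel₀ hq hmain

lemma distanceAtLeast_two {m : ℕ} (e : Fin q ≃ R) (a : Fin (m + 2) → Rˣ) :
    DistanceAtLeast (shiftCode e a) 2 := by
  intro S A hS hA
  obtain ⟨i, hi⟩ := Finset.card_le_one_iff_subset_singleton.1 (Nat.le_of_lt_succ hS)
  have := purelyDetects_of_actsOnlyOn e a hi hA
  exact ⟨⟨_, this⟩, fun _ => this⟩

/-! ### The distance is at most two -/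

open Classical in
/-- The uniform superposition of the orbit of a label `x`. -/
noncomputable def orbitState (e : Fin q ≃ R) (a : Fin n → Rˣ) (x : Fin n → Fin q) : Qudits n q :=
  WithLp.toLp 2 fun y => if ∃ t, shift e a t x = y then 1 else 0

open Classical in
lemma orbitState_apply (e : Fin q ≃ R) (a : Fin n → Rˣ) (x y : Fin n → Fin q) :
    orbitState e a x y = if ∃ t, shift e a t x = y then 1 else 0 := rfl

lemma shift_shift (e : Fin q ≃ R) (a : Fin n → Rˣ) (s t : R) (x : Fin n → Fin q) :
    shift e a s (shift e a t x) = shift e a (s + t) x := by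
  funext i
  apply e.injective
  simp only [shift_apply]
  ring

lemma shift_zero (e : Fin q ≃ R) (a : Fin n → Rˣ) (x : Fin n → Fin q) : shift e a 0 x = x := by
  funext i
  apply e.injective
  simp

lemma orbitState_mem (e : Fin q ≃ R) {a : Fin n → Rˣ} (ha : ∑ i, (a i : R) = 0)
    {x : Fin n → Fin q} (hx : ∑ i, e (x i) = 0) : orbitState e a x ∈ shiftCode e a := by
  refine ⟨fun y hy => ?_, fun t y => ?_⟩
  · rw [orbitState_apply, if_neg]
    rintro ⟨t, rfl⟩
    exact hy (by rw [sum_shift e ha, hx])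
  · rw [orbitState_apply, orbitState_apply]
    congr 1
    refine propext ⟨?_, ?_⟩
    · rintro ⟨s, hs⟩
      refine ⟨-t + s, ?_⟩
      rw [← shift_shift, hs, shift_shift, neg_add_cancel, shift_zero]
    · rintro ⟨s, rfl⟩
      exact ⟨t + s, (shift_shift _ _ _ _ _).symm⟩

lemma orbitState_ne_zero (e : Fin q ≃ R) (a : Fin n → Rˣ) (x : Fin n → Fin q) :
    orbitState e a x ≠ 0 := by
  intro h
  have h1 : orbitState e a x x = 0 := by rw [h]; rfl
  rw [orbitState_apply, if_pos ⟨0, shift_zero e a x⟩] at h1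
  exact one_ne_zero h1

open Classical in
/-- The projection onto the labels whose coordinates `i` and `j` are proportional to those of `a`. -/
noncomputable def pairProjection (e : Fin q ≃ R) (a : Fin n → Rˣ) (i j : Fin n) : Operator n q :=
  Matrix.diagonal fun x => if e (x i) * a j = e (x j) * a i then 1 else 0

lemma actsOnlyOn_pairProjection (e : Fin q ≃ R) (a : Fin n → Rˣ) (i j : Fin n) :
    ActsOnlyOn (pairProjection e a i j) {i, j} := by
  classical
  refine ⟨Matrix.diagonal fun z =>
    if e (z ⟨i, by simp⟩) * a j = e (z ⟨j, by simp⟩) * a i then 1 else 0, fun x y => ⟨?_, ?_⟩⟩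
  · intro h
    by_cases hxy : x = y
    · subst hxy
      simp [pairProjection]
    · rw [pairProjection, Matrix.diagonal_apply_ne _ hxy, Matrix.diagonal_apply_ne]
      refine fun h' => hxy (funext fun k => ?_)
      by_cases hk : k ∈ ({i, j} : Finset (Fin n))
      · exact congrFun h' ⟨k, hk⟩
      · exact h k hk
  · intro h
    rw [pairProjection, Matrix.diagonal_apply_ne]
    rintro rfl
    exact h fun _ _ => rfl

open Classical in
/-- Orbit states are eigenvectors of the pair projection. -/
lemma pairProjection_orbitState (e : Fin q ≃ R) (a : Fin n → Rˣ) (i j : Fin n)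
    (x : Fin n → Fin q) :
    Matrix.toEuclideanLin (pairProjection e a i j) (orbitState e a x) =
      (if e (x i) * a j = e (x j) * a i then (1 : ℂ) else 0) • orbitState e a x := by
  ext y
  rw [Matrix.toLpLin_apply, pairProjection]
  simp only [Matrix.mulVec_diagonal, PiLp.smul_apply, smul_eq_mul]
  rw [orbitState_apply]
  by_cases h : ∃ t, shift e a t x = y
  · obtain ⟨t, rfl⟩ := h
    simp only [shift_apply]
    congr 2
    refine propext ⟨fun h => ?_, fun h => ?_⟩ <;> linear_combination h
  · simp [h]

/-- If an orbit state is an eigenvector of a detected operator, its eigenvalue is the detection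
scalar. -/
lemma eigenvalue_eq_of_detects (e : Fin q ≃ R) {a : Fin n → Rˣ} (ha : ∑ i, (a i : R) = 0)
    {A : Operator n q} {c l : ℂ}
    (hc : ∀ u ∈ shiftCode e a, ∀ v ∈ shiftCode e a,
      inner ℂ u (Matrix.toEuclideanLin A v) = c * inner ℂ u v)
    {x : Fin n → Fin q} (hx : ∑ i, e (x i) = 0)
    (hl : Matrix.toEuclideanLin A (orbitState e a x) = l • orbitState e a x) : c = l := by
  have h := hc _ (orbitState_mem e ha hx) _ (orbitState_mem e ha hx)
  rw [hl, inner_smul_right] at h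
  exact (mul_right_cancel₀ (inner_self_ne_zero.2 (orbitState_ne_zero e a x)) h).symm

/-- The pair projection fixes the orbit state of the zero label, so its detection scalar would be 1.
For two qudits this contradicts pure detection, as its trace is below `q ^ 2`; for more, another
orbit state in the code is annihilated. -/
lemma not_distanceAtLeast {m : ℕ} [Nontrivial R] (e : Fin q ≃ R) {a : Fin (m + 2) → Rˣ}
    (ha : ∑ i, (a i : R) = 0) {d : ℕ} (hd : 2 < d) : ¬ DistanceAtLeast (shiftCode e a) d := by
  classical
  intro h
  obtain ⟨⟨c, hc⟩, hpure⟩ := h {0, 1} (pairProjection e a 0 1)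
    (lt_of_le_of_lt Finset.card_le_two hd) (actsOnlyOn_pairProjection e a 0 1)
  have hzero : ∑ i, e ((fun _ : Fin (m + 2) => e.symm 0) i) = 0 := by simp
  have hone := pairProjection_orbitState e a 0 1 (fun _ => e.symm 0)
  rw [if_pos (by simp)] at hone
  rcases m with _ | m
  · have htr := eigenvalue_eq_of_detects e ha
      (hpure (by rw [finrank_shiftCode e ha, pow_zero])) hzero hone
    rw [pairProjection, Matrix.trace_diagonal, Finset.sum_boole] at htr
    have hlt : (Finset.univ.filter fun x : Fin 2 → Fin q =>
        e (x 0) * a 1 = e (x 1) * a 0).card < q ^ 2 := by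
      have : Fintype.card (Fin 2 → Fin q) = q ^ 2 := by simp
      rw [← this]
      refine Finset.card_lt_univ_of_notMem (x := ![e.symm 1, e.symm 0]) ?_
      simp
    have hq : (q : ℂ) ^ 2 ≠ 0 := by
      intro h0
      simp [h0] at htr
    rw [div_eq_one_iff_eq (by simpa using hq)] at htr
    exact hlt.ne (by exact_mod_cast htr)
  -- With a third qudit, the entry balancing the sum can avoid coordinates 0 and 1, which become
  -- `(1, 0)`, not proportional to `(a 0, a 1)`.
  · let y : Fin (m + 3) → R := Pi.single 0 1 - Pi.single (Fin.last _) 1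
    have hy : ∑ i, e ((fun i => e.symm (y i)) i) = 0 := by simp [y]
    have hnull := pairProjection_orbitState e a 0 1 (fun i => e.symm (y i))
    have hy0 : y 0 = 1 := by simp [y, Fin.ext_iff]
    have hy1 : y 1 = 0 := by simp [y, Fin.ext_iff]
    rw [if_neg (by simp [hy0, hy1])] at hnull
    have h1 := eigenvalue_eq_of_detects e ha hc hzero hone
    have h0 := eigenvalue_eq_of_detects e ha hc hy hnull
    exact one_ne_zero (h1.symm.trans h0)

end ShiftCode

/-- A vanishing sum of `n` units in a ring with `q` elements gives a code `[[n, n - 2, 2]]_q`. -/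
lemma exists_isMDSCode (R : Type) [CommRing R] {n q : ℕ} (hq : 1 < q) (hR : Nat.card R = q)
    (hn : 2 ≤ n) (h : ∃ a : Fin n → Rˣ, ∑ i, (a i : R) = 0) :
    ∃ C : Submodule ℂ (Qudits n q), IsMDSCode C (n - 2) 2 := by
  obtain ⟨m, rfl⟩ := Nat.exists_eq_add_of_le' hn
  obtain ⟨a, ha⟩ := h
  have : Finite R := Nat.finite_of_card_ne_zero (by omega)
  have : Nontrivial R := Finite.one_lt_card_iff_nontrivial.1 (by omega)
  let e : Fin q ≃ R := (Finite.equivFinOfCardEq hR).symm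
  refine ⟨shiftCode e a, ⟨finrank_shiftCode e ha, distanceAtLeast_two e a, fun d hd => ?_⟩,
    by omega⟩
  by_contra hlt
  exact not_distanceAtLeast e ha (not_le.1 hlt) hd

end QuantumCode

theorem mainTheorem3 (q : ℕ) (hq : 1 < q) :
    (∀ n : ℕ, 2 ≤ n → Even n →
      ∃ C : Submodule ℂ (QuantumCode.Qudits n q), QuantumCode.IsMDSCode C (n - 2) 2) ∧
    ((Odd q ∨ 4 ∣ q) → ∀ n : ℕ, 2 ≤ n →
      ∃ C : Submodule ℂ (QuantumCode.Qudits n q), QuantumCode.IsMDSCode C (n - 2) 2) := by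
  refine ⟨fun n hn heven => ?_, fun h n hn => ?_⟩
  · exact QuantumCode.exists_isMDSCode (ZMod q) hq (Nat.card_zmod q) hn
      (QuantumCode.exists_units_sum_eq_zero_of_even _ heven)
  · obtain ⟨R, _, hR, u, hu, hu'⟩ := QuantumCode.exists_ring_unit_add_one_unit (by omega) h
    exact QuantumCode.exists_isMDSCode R hq hR hn
      (QuantumCode.exists_units_sum_eq_zero R hu hu' hn)
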